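/- All graphs are finite and simple. For a graph $G$ let $\delta(G)$ be its minimum degree, and let $\kappa(G)$ be its connectivity, i.e. the least number of vertices whose deletion leaves a disconnected graph or a graph with at most one vertex; $G$ is $k$-connected if $\kappa(G)\ge k$. Let $\mu_1(G)$ be the largest eigenvalue of the Laplacian matrix $L(G)=D(G)-A(G)$, where $A(G)$ is the adjacency matrix and $D(G)$ is the diagonal matrix of vertex degrees. $G$ is Hamiltonian-connected if every two distinct vertices are joined by a Hamiltonian path, Hamiltonian if it has a Hamiltonian cycle, and traceable if it has a Hamiltonian path. **Theorem.** Let $k\ge 0$ be an integer, let $G$ be a $k$-connected graph of order $n\ge 3$ with minimum degree $\delta=\delta(G)$, let $s\in\{1,0,-1\}$ with $n-k+s-1\neq 0$, and suppose that $$\mu_1(G)<\frac{n\delta}{n-k+s-1}.$$ Then each of the following holds. (i) If $s=1$, then $G$ is Hamiltonian-connected. (ii) If $s=0$, then $G$ is Hamiltonian. (iii) If $s=-1$, then $G$ is traceable. The condition is best possible: for every $s\in\{1,0,-1\}$ and every integer $k\ge 0$ such that $n:=2k-s+1\ge 3$, the complete bipartite graph $H=K_{k,k-s+1}$, of order $n$,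 is $k$-connected and satisfies $$\mu_1(H)=2k-s+1=\frac{n\,\delta(H)}{n-k+s-1},$$ but $H$ is not Hamiltonian-connected if $s=1$, not Hamiltonian if $s=0$, and not traceable if $s=-1$. -/

import Mathlib

namespace SimpleGraph

/-- The connectivity `κ(G)` of a finite graph: the least number of vertices whose deletion leaves
a graph that is disconnected or has at most one vertex. (So `κ(K_n) = n - 1`.) -/
noncomputable def vertexConnectivity {V : Type*} [Fintype V] (G : SimpleGraph V) : ℕ :=
  sInf {m : ℕ | ∃ S : Finset V, S.card = m ∧
    (¬ (G.induce {v : V | v ∉ S}).Connected ∨ Fintype.card V ≤ S.card + 1)}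

/-- A graph is `k`-connected if `κ(G) ≥ k`. -/
def IsKConnected {V : Type*} [Fintype V] (G : SimpleGraph V) (k : ℕ) : Prop :=
  k ≤ G.vertexConnectivity

/-- The Laplacian spectral radius `μ₁(G)`: the largest eigenvalue of the Laplacian matrix
`L(G) = D(G) - A(G)`. -/
noncomputable def laplacianSpectralRadius {V : Type*} [Fintype V] [DecidableEq V]
    (G : SimpleGraph V) [DecidableRel G.Adj] : ℝ :=
  ⨆ v : V, (G.isHermitian_lapMatrix ℝ).eigenvalues v

/-- Every two distinct vertices are the ends of a Hamiltonian path. -/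
def IsHamiltonianConnected {V : Type*} [DecidableEq V] (G : SimpleGraph V) : Prop :=
  ∀ u v : V, u ≠ v → ∃ p : G.Walk u v, p.IsHamiltonian

/-- The graph contains a Hamiltonian path. -/
def IsTraceable {V : Type*} [DecidableEq V] (G : SimpleGraph V) : Prop :=
  ∃ (u v : V) (p : G.Walk u v), p.IsHamiltonian

end SimpleGraph

/-! The spectral hypothesis enters only through the independence number. Testing the Laplacian
quadratic form on the centred indicator of an independent set `I` gives `n * δ ≤ μ₁ * (n - |I|)`;
together with the hypothesis this forces `|I| ≤ k - s`. The three conclusions are then the three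
forms of the Chvátal–Erdős theorem.

Those share one extremal argument. Let a longest admissible path miss a vertex `w`, and let `C` be
the component of `w` off the path. The successors on the path of the neighbours of `C`, together
with `w`, are independent, since any edge among them reroutes the path through `C` and lengthens it.
Connectivity gives at least `k` such neighbours, hence too large an independent set.

For sharpness, `K_{k,l}` has `μ₁ = n`, and since a Hamiltonian path alternates sides, its ends
determine the difference `k - l`. -/

namespace SimpleGraph

open Matrix Finset

/-! ### Laplacian spectral radius and the ratio bound -/

section Spectral

variable {V : Type*} [Fintype V] [DecidableEq V] (G : SimpleGraph V) [DecidableRel G.Adj]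

/-- The Rayleigh quotient of a real Hermitian matrix is at most its largest eigenvalue. -/
theorem _root_.Matrix.IsHermitian.dotProduct_mulVec_le_iSup_eigenvalues {A : Matrix V V ℝ}
    (hA : A.IsHermitian) (x : V → ℝ) :
    x ⬝ᵥ A *ᵥ x ≤ (⨆ v, hA.eigenvalues v) * (x ⬝ᵥ x) := by
  -- Parseval in the eigenbasis: both sides become sums over eigenvectors, compared term by term.
  have key (y : V → ℝ) : x ⬝ᵥ y =
      ∑ i, (x ⬝ᵥ ⇑(hA.eigenvectorBasis i)) * (⇑(hA.eigenvectorBasis i) ⬝ᵥ y) := by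
    have h := hA.eigenvectorBasis.sum_inner_mul_inner (WithLp.toLp 2 x) (WithLp.toLp 2 y)
    simp only [EuclideanSpace.inner_eq_star_dotProduct, star_trivial] at h
    rw [dotProduct_comm, ← h]
    refine Finset.sum_congr rfl fun i _ => ?_
    rw [dotProduct_comm x, dotProduct_comm _ y]
  rw [key, key, Finset.mul_sum]
  refine Finset.sum_le_sum fun i _ => ?_
  have hsymm : Aᵀ = A := by simpa [conjTranspose_eq_transpose_of_trivial] using hA.eq
  have hmul : ⇑(hA.eigenvectorBasis i) ⬝ᵥ A *ᵥ x =
      hA.eigenvalues i * (⇑(hA.eigenvectorBasis i) ⬝ᵥ x) := by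
    rw [dotProduct_mulVec, ← mulVec_transpose, hsymm, hA.mulVec_eigenvectorBasis, smul_dotProduct,
      smul_eq_mul]
  rw [hmul, dotProduct_comm x, mul_left_comm]
  exact mul_le_mul_of_nonneg_right (le_ciSup (Set.finite_range _).bddAbove i) (mul_self_nonneg _)

theorem dotProduct_lapMatrix_mulVec (x : V → ℝ) :
    x ⬝ᵥ G.lapMatrix ℝ *ᵥ x =
      (∑ i : V, ∑ j : V, if G.Adj i j then (x i - x j) ^ 2 else 0) / 2 := by
  rw [← lapMatrix_toLinearMap₂', Matrix.toLinearMap₂'_apply']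

theorem dotProduct_lapMatrix_mulVec_le (x : V → ℝ) :
    x ⬝ᵥ G.lapMatrix ℝ *ᵥ x ≤ G.laplacianSpectralRadius * (x ⬝ᵥ x) :=
  (G.isHermitian_lapMatrix ℝ).dotProduct_mulVec_le_iSup_eigenvalues x

theorem laplacianSpectralRadius_nonneg : 0 ≤ G.laplacianSpectralRadius :=
  Real.iSup_nonneg fun i => (posSemidef_lapMatrix ℝ G).eigenvalues_nonneg i

/-- The Laplacian eigenvalues of a graph on `n` vertices are at most `n`. -/
theorem laplacianSpectralRadius_le_card : G.laplacianSpectralRadius ≤ Fintype.card V := by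
  refine Real.iSup_le (fun i => ?_) (Nat.cast_nonneg _)
  set b : V → ℝ := ⇑((G.isHermitian_lapMatrix ℝ).eigenvectorBasis i) with hb
  have hbb : b ⬝ᵥ b = 1 := by
    have h := (G.isHermitian_lapMatrix ℝ).eigenvectorBasis.orthonormal.1 i
    have h2 := real_inner_self_eq_norm_sq ((G.isHermitian_lapMatrix ℝ).eigenvectorBasis i)
    rw [h] at h2
    rwa [EuclideanSpace.inner_eq_star_dotProduct, star_trivial, one_pow] at h2
  have h1 : b ⬝ᵥ G.lapMatrix ℝ *ᵥ b = (G.isHermitian_lapMatrix ℝ).eigenvalues i := by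
    rw [hb, (G.isHermitian_lapMatrix ℝ).mulVec_eigenvectorBasis, dotProduct_smul, ← hb, hbb]
    simp
  -- Comparison with the complete graph, whose form is at most `n` times the squared norm.
  have h2 : (∑ i : V, ∑ j : V, if G.Adj i j then (b i - b j) ^ 2 else 0) ≤
      ∑ i : V, ∑ j : V, (b i - b j) ^ 2 :=
    Finset.sum_le_sum fun i _ => Finset.sum_le_sum fun j _ => by
      split_ifs
      exacts [le_rfl, sq_nonneg _]
  have h3 : ∑ i : V, ∑ j : V, (b i - b j) ^ 2 =
      2 * Fintype.card V * (b ⬝ᵥ b) - 2 * (∑ i, b i) ^ 2 := by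
    simp only [sub_sq, Finset.sum_add_distrib, Finset.sum_sub_distrib, Finset.sum_const,
      Finset.card_univ, nsmul_eq_mul, ← Finset.mul_sum, ← Finset.sum_mul, dotProduct, ← sq]
    ring
  rw [← h1, dotProduct_lapMatrix_mulVec]
  rw [h3, hbb] at h2
  nlinarith [sq_nonneg (∑ i, b i)]

/-- An eigenvalue of the Laplacian matrix is at most the Laplacian spectral radius. -/
theorem le_laplacianSpectralRadius {x : V → ℝ} (hx : x ≠ 0) {a : ℝ}
    (h : G.lapMatrix ℝ *ᵥ x = a • x) : a ≤ G.laplacianSpectralRadius := by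
  have h1 := G.dotProduct_lapMatrix_mulVec_le x
  rw [h, dotProduct_smul, smul_eq_mul] at h1
  refine le_of_mul_le_mul_right h1 (lt_of_le_of_ne ?_ ?_)
  · exact Finset.sum_nonneg fun i _ => mul_self_nonneg _
  · exact fun h0 => hx (dotProduct_self_eq_zero.mp h0.symm)

/-- The ratio bound for independent sets, in terms of the Laplacian spectral radius. -/
theorem IsIndepSet.card_mul_minDegree_le {I : Finset V} (hI : G.IsIndepSet (I : Set V))
    (hne : I.Nonempty) :
    (Fintype.card V : ℝ) * G.minDegree ≤
      G.laplacianSpectralRadius * ((Fintype.card V : ℝ) - I.card) := by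
  set n : ℝ := (Fintype.card V : ℝ) with hn
  have hn0 : 0 < n := by
    exact Nat.cast_pos.mpr (Fintype.card_pos_iff.mpr ⟨hne.choose⟩)
  have hI0 : (0 : ℝ) < I.card := Nat.cast_pos.mpr hne.card_pos
  set ind : V → ℝ := fun v => if v ∈ I then 1 else 0 with hind
  -- The indicator of `I` made orthogonal to the constants, scaled by `n` to avoid division.
  set x : V → ℝ := fun v => n * ind v - I.card with hx
  have hsum : ∑ v, ind v = I.card := by simp [hind]
  have hxx : x ⬝ᵥ x = n * I.card * (n - I.card) := by
    have h1 (v : V) : x v * x v = (n ^ 2 - 2 * n * I.card) * ind v + (I.card : ℝ) ^ 2 := by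
      simp only [hx, hind]; split_ifs <;> ring
    simp only [dotProduct, h1, Finset.sum_add_distrib, ← Finset.mul_sum, hsum, Finset.sum_const,
      Finset.card_univ, nsmul_eq_mul]
    rw [← hn]; ring
  have hLx : n ^ 2 * (G.minDegree * I.card) ≤ x ⬝ᵥ G.lapMatrix ℝ *ᵥ x := by
    -- An edge has at most one end in `I`, so the square has no cross term.
    have h1 (i j : V) : (if G.Adj i j then (x i - x j) ^ 2 else 0) =
        n ^ 2 * (ind i * (if G.Adj i j then 1 else 0)) +
          n ^ 2 * (ind j * (if G.Adj i j then 1 else 0)) := by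
      have h2 : G.Adj i j → ¬ (i ∈ I ∧ j ∈ I) := fun hij hmem =>
        hI hmem.1 hmem.2 hij.ne hij
      simp only [hx, hind]
      split_ifs <;> (simp_all; try ring)
    have h3 (i : V) : ∑ j, (if G.Adj i j then (1 : ℝ) else 0) = G.degree i :=
      (degree_eq_sum_if_adj G i).symm
    have h4 (j : V) : ∑ i, (if G.Adj i j then (1 : ℝ) else 0) = G.degree j := by
      simp_rw [G.adj_comm _ j, h3]
    have h5 : x ⬝ᵥ G.lapMatrix ℝ *ᵥ x = n ^ 2 * ∑ i, ind i * G.degree i := by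
      rw [dotProduct_lapMatrix_mulVec]
      simp_rw [h1, Finset.sum_add_distrib]
      rw [Finset.sum_comm (f := fun i j => n ^ 2 * (ind j * (if G.Adj i j then 1 else 0)))]
      simp_rw [← Finset.mul_sum, h3, h4]
      ring
    rw [h5, ← hsum, Finset.mul_sum]
    refine mul_le_mul_of_nonneg_left (Finset.sum_le_sum fun i _ => ?_) (sq_nonneg _)
    rw [mul_comm]
    refine mul_le_mul_of_nonneg_left (Nat.cast_le.mpr (G.minDegree_le_degree i)) ?_
    simp only [hind]; split_ifs <;> simp
  have h := hLx.trans (G.dotProduct_lapMatrix_mulVec_le x)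
  rw [hxx] at h
  refine le_of_mul_le_mul_left (a := n * I.card) ?_ (by positivity)
  nlinarith

end Spectral

end SimpleGraph

namespace SimpleGraph

/-! ### Rerouting longest paths through a component -/

section LongPaths

variable {V : Type*} {G : SimpleGraph V}

/-- `G.IsPathList l` says that `l` lists the vertices of a (possibly empty) path of `G`. -/
def IsPathList (G : SimpleGraph V) (l : List V) : Prop :=
  l.IsChain G.Adj ∧ l.Nodup

theorem IsPathList.append {l m : List V} (hl : G.IsPathList l) (hm : G.IsPathList m)
    (h : ∀ x ∈ l.getLast?, ∀ y ∈ m.head?, G.Adj x y) (hd : l.Disjoint m) :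
    G.IsPathList (l ++ m) :=
  ⟨hl.1.append hm.1 h, List.nodup_append.mpr ⟨hl.2, hm.2, fun _ ha _ hb hab =>
    hd ha (hab ▸ hb)⟩⟩

theorem IsPathList.left {l m : List V} (h : G.IsPathList (l ++ m)) : G.IsPathList l :=
  ⟨h.1.left_of_append, h.2.of_append_left⟩

theorem IsPathList.right {l m : List V} (h : G.IsPathList (l ++ m)) : G.IsPathList m :=
  ⟨h.1.right_of_append, h.2.of_append_right⟩

theorem IsPathList.disjoint {l m : List V} (h : G.IsPathList (l ++ m)) : l.Disjoint m :=
  List.disjoint_of_nodup_append h.2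

theorem IsPathList.reverse {l : List V} (h : G.IsPathList l) : G.IsPathList l.reverse := by
  refine ⟨?_, List.nodup_reverse.mpr h.2⟩
  rw [List.isChain_reverse]
  exact h.1.imp fun _ _ hab => hab.symm

/-- Any two vertices of `C` are the ends of a path inside `C`. -/
def LinkedSet (G : SimpleGraph V) (C : Set V) : Prop :=
  ∀ a ∈ C, ∀ b ∈ C, ∃ q : List V, G.IsPathList q ∧ (∀ z ∈ q, z ∈ C) ∧
    q.head? = some a ∧ q.getLast? = some b

/-- Reachability of each path vertex is recorded so that the path is known to stay in one component,
not merely in `s`. -/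
theorem Reachable.exists_isPathList {s : Set V} {a b : s} (h : (G.induce s).Reachable a b) :
    ∃ q : List V, G.IsPathList q ∧ (∀ z ∈ q, ∃ c : s, c = z ∧ (G.induce s).Reachable a c) ∧
      q.head? = some a.1 ∧ q.getLast? = some b.1 := by
  classical
  obtain ⟨p, hp⟩ := h.exists_isPath
  refine ⟨p.support.map Subtype.val, ⟨?_, ?_⟩, ?_, ?_, ?_⟩
  · rw [List.isChain_map]
    exact p.isChain_adj_support
  · exact hp.support_nodup.map Subtype.val_injective
  · intro z hz
    obtain ⟨c, hc, rfl⟩ := List.mem_map.mp hz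
    exact ⟨c, rfl, ⟨p.takeUntil c hc⟩⟩
  · rw [List.head?_map, List.head?_eq_some_head p.support_ne_nil, p.head_support]; rfl
  · rw [List.getLast?_map, List.getLast?_eq_some_getLast p.support_ne_nil, p.getLast_support]; rfl

theorem Connected.linkedSet {s : Set V} (h : (G.induce s).Connected) : G.LinkedSet s := by
  intro a ha b hb
  obtain ⟨q, h1, h2, h3⟩ := (h.preconnected ⟨a, ha⟩ ⟨b, hb⟩).exists_isPathList
  refine ⟨q, h1, fun z hz => ?_, h3⟩
  obtain ⟨c, rfl, -⟩ := h2 z hz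
  exact c.2

/-- The vertices that can be reached from `w` while avoiding `l` form a linked set, whose
neighbours outside the set all belong to `l`. -/
theorem exists_linkedSet_of_notMem {l : List V} {w : V} (hw : w ∉ l) :
    ∃ C : Set V, w ∈ C ∧ (∀ z ∈ C, z ∉ l) ∧ G.LinkedSet C ∧
      ∀ z ∈ C, ∀ y, G.Adj z y → y ∉ C → y ∈ l := by
  let s : Set V := {v | v ∉ l}
  let w' : s := ⟨w, hw⟩
  refine ⟨{v | ∃ c : s, c = v ∧ (G.induce s).Reachable w' c}, ⟨w', rfl, .refl _⟩, ?_, ?_, ?_⟩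
  · rintro _ ⟨c, rfl, -⟩
    exact c.2
  · rintro _ ⟨a, rfl, ha⟩ _ ⟨b, rfl, hb⟩
    obtain ⟨q, h1, h2, h3⟩ := (ha.symm.trans hb).exists_isPathList
    refine ⟨q, h1, fun z hz => ?_, h3⟩
    obtain ⟨c, hc, hac⟩ := h2 z hz
    exact ⟨c, hc, ha.trans hac⟩
  · rintro _ ⟨a, rfl, ha⟩ y hay hy
    by_contra hyl
    refine hy ⟨⟨y, hyl⟩, rfl, ha.trans (Adj.reachable ?_)⟩
    simpa using hay

/-- The vertices of `l` that succeed a neighbour of the set `C` along the list `l`. -/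
def succNeighbors (G : SimpleGraph V) (l : List V) (C : Set V) : Set V :=
  {y | ∃ A B x, l = A ++ B ∧ A.getLast? = some x ∧ B.head? = some y ∧ ∃ h ∈ C, G.Adj x h}

variable {l : List V} {C : Set V}

theorem succNeighbors_subset {y : V} (hy : y ∈ G.succNeighbors l C) : y ∈ l := by
  obtain ⟨A, B, x, rfl, -, hB, -⟩ := hy
  exact List.mem_append_right _ (List.mem_of_mem_head? hB)

/-- No path with the same ends as `l` is longer than `l`. -/
def IsLongestWithEnds (G : SimpleGraph V) (l : List V) : Prop :=
  ∀ m, G.IsPathList m → m.head? = l.head? → m.getLast? = l.getLast? → m.length ≤ l.length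

theorem head?_append_append {A B q : List V} (hA : A ≠ []) :
    (A ++ (q ++ B)).head? = (A ++ B).head? := by
  cases A <;> simp_all

theorem getLast?_append_append {A B q : List V} (hB : B ≠ []) :
    (A ++ (q ++ B)).getLast? = (A ++ B).getLast? := by
  rw [← List.append_assoc, List.getLast?_append_of_ne_nil _ hB, List.getLast?_append_of_ne_nil _ hB]

theorem ne_nil_of_head? {q : List V} {a : V} (h : q.head? = some a) : q ≠ [] := by
  rintro rfl; simp at h

theorem ne_nil_of_getLast? {q : List V} {a : V} (h : q.getLast? = some a) : q ≠ [] := by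
  rintro rfl; simp at h

/-- Otherwise a detour through `C` fits between `y` and its predecessor. -/
theorem IsLongestWithEnds.not_adj_succ (hl : G.IsPathList l) (hmax : G.IsLongestWithEnds l)
    (hC : G.LinkedSet C) (hCl : ∀ z ∈ C, z ∉ l) {y : V} (hy : y ∈ G.succNeighbors l C)
    {h : V} (hh : h ∈ C) : ¬ G.Adj y h := by
  intro hyh
  obtain ⟨A, B, x, rfl, hA, hB, h', hh', hxh'⟩ := hy
  obtain ⟨q, hq, hqC, hq1, hq2⟩ := hC h' hh' h hh
  have h1 : G.IsPathList (A ++ (q ++ B)) := by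
    refine hl.left.append (hq.append hl.right ?_ ?_) ?_ ?_
    · intro a ha b hb
      simp_all [G.adj_comm]
    · exact fun z hz hzB => hCl z (hqC z hz) (List.mem_append_right _ hzB)
    · intro a ha b hb
      rw [List.head?_append, hq1] at hb
      simp_all
    · intro z hz hz'
      rcases List.mem_append.mp hz' with hz' | hz'
      · exact hCl z (hqC z hz') (List.mem_append_left _ hz)
      · exact hl.disjoint hz hz'
  have h2 := hmax _ h1 (head?_append_append (ne_nil_of_getLast? hA))
    (getLast?_append_append (ne_nil_of_head? hB))
  have h3 := List.length_pos_iff.mpr (ne_nil_of_head? hq1)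
  simp only [List.length_append] at h2
  omega

/-- With the edge `y y'`, one could follow `A` to `x`, cross `C` to `x'`, run `M` backwards to `y`
and continue with `B`: same ends, but longer. -/
theorem IsLongestWithEnds.not_adj_of_cut {A M B : List V} (hl : G.IsPathList (A ++ (M ++ B)))
    (hmax : G.IsLongestWithEnds (A ++ (M ++ B)))
    (hC : G.LinkedSet C) (hCl : ∀ z ∈ C, z ∉ A ++ (M ++ B)) {x y x' y' h h' : V}
    (hA : A.getLast? = some x) (hM : M.head? = some y) (hM' : M.getLast? = some x')
    (hB : B.head? = some y') (hh : h ∈ C) (hxh : G.Adj x h) (hh' : h' ∈ C)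
    (hxh' : G.Adj x' h') : ¬ G.Adj y y' := by
  intro hyy
  obtain ⟨q, hq, hqC, hq1, hq2⟩ := hC h hh h' hh'
  have hMr : M.reverse.head? = some x' := by rw [List.head?_reverse, hM']
  have hMr' : M.reverse.getLast? = some y := by rw [List.getLast?_reverse, hM]
  have h1 : G.IsPathList (A ++ (q ++ (M.reverse ++ B))) := by
    refine hl.left.append (hq.append (hl.right.left.reverse.append hl.right.right ?_ ?_) ?_ ?_) ?_ ?_
    · intro a ha b hb
      simp_all
    · intro z hz
      exact hl.right.disjoint (List.mem_reverse.mp hz)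
    · intro a ha b hb
      rw [List.head?_append, hMr] at hb
      simp_all [G.adj_comm]
    · intro z hz hz'
      apply hCl z (hqC z hz)
      simp_all
    · intro a ha b hb
      rw [List.head?_append, hq1] at hb
      simp_all
    · intro z hz hz'
      rcases List.mem_append.mp hz' with hz' | hz'
      · exact hCl z (hqC z hz') (List.mem_append_left _ hz)
      · exact hl.disjoint hz (by simpa using hz')
  have hA0 := ne_nil_of_getLast? hA
  have hB0 := ne_nil_of_head? hB
  have h2 := hmax _ h1 (by rw [List.head?_append_of_ne_nil _ hA0, List.head?_append_of_ne_nil _ hA0])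
    (by simp only [← List.append_assoc, List.getLast?_append_of_ne_nil _ hB0])
  have h3 := List.length_pos_iff.mpr (ne_nil_of_head? hq1)
  simp only [List.length_append, List.length_reverse] at h2
  omega

theorem IsLongestWithEnds.not_adj_succ_succ (hl : G.IsPathList l) (hmax : G.IsLongestWithEnds l)
    (hC : G.LinkedSet C) (hCl : ∀ z ∈ C, z ∉ l) {y y' : V} (hy : y ∈ G.succNeighbors l C)
    (hy' : y' ∈ G.succNeighbors l C) : ¬ G.Adj y y' := by
  obtain ⟨A, B, x, rfl, hA, hB, h, hh, hxh⟩ := hy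
  obtain ⟨A', B', x', hl', hA', hB', h', hh', hxh'⟩ := hy'
  rcases List.append_eq_append_iff.mp hl' with ⟨M, rfl, rfl⟩ | ⟨M, rfl, rfl⟩
  · rcases eq_or_ne M [] with rfl | hM
    · simp_all
    · rw [List.head?_append_of_ne_nil _ hM] at hB
      rw [List.getLast?_append_of_ne_nil _ hM] at hA'
      exact not_adj_of_cut hl hmax hC hCl hA hB hA' hB' hh hxh hh' hxh'
  · rcases eq_or_ne M [] with rfl | hM
    · simp_all
    · rw [hl'] at hl hmax hCl
      rw [List.head?_append_of_ne_nil _ hM] at hB'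
      rw [List.getLast?_append_of_ne_nil _ hM] at hA
      intro hyy
      exact not_adj_of_cut hl hmax hC hCl hA' hB' hA hB hh' hxh' hh hxh hyy.symm

/-- The vertices of `l` with a neighbour in `C`. -/
def listBoundary (G : SimpleGraph V) (l : List V) (C : Set V) : Set V :=
  {x | x ∈ l ∧ ∃ h ∈ C, G.Adj x h}

theorem exists_succ_of_mem {x : V} (hx : x ∈ l) (hlast : l.getLast? ≠ some x) :
    ∃ A B y, l = A ++ B ∧ A.getLast? = some x ∧ B.head? = some y := by
  obtain ⟨A, B, rfl⟩ := List.append_of_mem hx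
  cases B with
  | nil => simp at hlast
  | cons y B => exact ⟨A ++ [x], y :: B, y, by simp, by simp, by simp⟩

theorem eq_of_append_eq_append_of_head? {A B A' B' : List V} {y : V} (hl : (A ++ B).Nodup)
    (h : A ++ B = A' ++ B') (hB : B.head? = some y) (hB' : B'.head? = some y) : A = A' := by
  rcases List.append_eq_append_iff.mp h with ⟨M, rfl, rfl⟩ | ⟨M, rfl, rfl⟩
  · rcases eq_or_ne M [] with rfl | hM
    · simp
    · rw [List.head?_append_of_ne_nil _ hM] at hB
      exact absurd (List.mem_of_mem_head? hB')
        (List.disjoint_of_nodup_append hl.of_append_right (List.mem_of_mem_head? hB))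
  · rcases eq_or_ne M [] with rfl | hM
    · simp
    · rw [List.head?_append_of_ne_nil _ hM] at hB'
      rw [h] at hl
      exact absurd (List.mem_of_mem_head? hB)
        (List.disjoint_of_nodup_append hl.of_append_right (List.mem_of_mem_head? hB'))

/-- Taking successors is injective on a list without repetition; only the last vertex has none. -/
theorem ncard_listBoundary_diff_le (hl : l.Nodup) :
    (G.listBoundary l C \ {x | l.getLast? = some x}).ncard ≤ (G.succNeighbors l C).ncard := by
  have key : ∀ x ∈ G.listBoundary l C \ {x | l.getLast? = some x}, ∃ y, ∃ A B,
      l = A ++ B ∧ A.getLast? = some x ∧ B.head? = some y := by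
    intro x hx
    obtain ⟨A, B, y, h⟩ := exists_succ_of_mem hx.1.1 hx.2
    exact ⟨y, A, B, h⟩
  choose! f hf using key
  refine Set.ncard_le_ncard_of_injOn f ?_ ?_ ?_
  · intro x hx
    obtain ⟨A, B, h1, h2, h3⟩ := hf x hx
    exact ⟨A, B, x, h1, h2, h3, hx.1.2⟩
  · intro x hx x' hx' hxx
    obtain ⟨A, B, rfl, h2, h3⟩ := hf x hx
    obtain ⟨A', B', h1', h2', h3'⟩ := hf x' hx'
    rw [← hxx] at h3'
    obtain rfl := eq_of_append_eq_append_of_head? hl h1' h3 h3'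
    simp_all
  · exact (List.finite_toSet l).subset fun y hy => succNeighbors_subset hy

theorem IsLongestWithEnds.isIndepSet (hl : G.IsPathList l) (hmax : G.IsLongestWithEnds l)
    (hC : G.LinkedSet C) (hCl : ∀ z ∈ C, z ∉ l) {w : V} (hw : w ∈ C) :
    G.IsIndepSet (insert w (G.succNeighbors l C)) := by
  refine Set.Pairwise.insert (fun y hy y' hy' _ => hmax.not_adj_succ_succ hl hC hCl hy hy') ?_
  intro y hy _
  have h := hmax.not_adj_succ hl hC hCl hy hw
  exact ⟨fun h' => h h'.symm, h⟩

theorem head?_notMem_succNeighbors (hl : l.Nodup) {u : V} (hu : l.head? = some u) :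
    u ∉ G.succNeighbors l C := by
  rintro ⟨A, B, x, rfl, hA, hB, -⟩
  rw [List.head?_append_of_ne_nil _ (ne_nil_of_getLast? hA)] at hu
  exact List.disjoint_of_nodup_append hl (List.mem_of_mem_head? hu) (List.mem_of_mem_head? hB)

theorem exists_mem_head? (hl : l ≠ []) : ∃ u, l.head? = some u :=
  ⟨_, List.head?_eq_some_head hl⟩

theorem exists_mem_getLast? (hl : l ≠ []) : ∃ u, l.getLast? = some u :=
  ⟨_, List.getLast?_eq_some_getLast hl⟩

/-- In a longest path with given ends and at least two vertices, not every vertex has a neighbour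
in a linked set avoiding the path. -/
theorem IsLongestWithEnds.exists_mem_forall_not_adj (hl : G.IsPathList l)
    (hmax : G.IsLongestWithEnds l) (h2 : 2 ≤ l.length)
    (hC : G.LinkedSet C) (hCl : ∀ z ∈ C, z ∉ l) : ∃ z ∈ l, ∀ h ∈ C, ¬ G.Adj z h := by
  by_contra! hall
  obtain ⟨a, b, m, rfl⟩ : ∃ a b m, l = a :: b :: m := by
    match l, h2 with
    | a :: b :: m, _ => exact ⟨a, b, m, rfl⟩
  obtain ⟨h, hh, hbh⟩ := hall b (by simp)
  exact hmax.not_adj_succ hl hC hCl ⟨[a], b :: m, a, rfl, rfl, rfl, hall a (by simp)⟩ hh hbh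

/-- The first vertex is nobody's successor, so it can supply one extra independent vertex. The
conditions on `u` come from maximality among all paths or all cycles. -/
theorem IsLongestWithEnds.isIndepSet_insert_head (hl : G.IsPathList l)
    (hmax : G.IsLongestWithEnds l)
    (hC : G.LinkedSet C) (hCl : ∀ z ∈ C, z ∉ l) {w u : V} (hw : w ∈ C)
    (huC : ∀ h ∈ C, ¬ G.Adj u h) (huT : ∀ y ∈ G.succNeighbors l C, ¬ G.Adj u y) :
    G.IsIndepSet (insert u (insert w (G.succNeighbors l C))) := by
  refine Set.Pairwise.insert (hmax.isIndepSet hl hC hCl hw) ?_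
  intro y hy _
  have h : ¬ G.Adj u y := by
    rcases hy with rfl | hy
    exacts [huC _ hw, huT _ hy]
  exact ⟨h, fun h' => h h'.symm⟩

end LongPaths

end SimpleGraph

namespace SimpleGraph

/-! ### The Chvátal–Erdős theorems -/

section ChvatalErdos

variable {V : Type*} [Fintype V] {G : SimpleGraph V} {l : List V} {C : Set V} {k : ℕ}

theorem IsKConnected.connected_induce (hk : G.IsKConnected k) {S : Finset V} (hS : S.card < k) :
    (G.induce {v : V | v ∉ S}).Connected := by
  by_contra h
  exact absurd (hk.trans (Nat.sInf_le ⟨S, rfl, Or.inl h⟩)) (by omega)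

theorem IsKConnected.lt_card [Nonempty V] (hk : G.IsKConnected k) : k < Fintype.card V := by
  obtain ⟨v⟩ := ‹Nonempty V›
  have hpos : 0 < Fintype.card V := Fintype.card_pos_iff.mpr ⟨v⟩
  obtain ⟨S, -, hS⟩ := Finset.exists_subset_card_eq
    (show Fintype.card V - 1 ≤ (Finset.univ : Finset V).card by rw [Finset.card_univ]; omega)
  have h : k ≤ S.card := hk.trans (Nat.sInf_le ⟨S, rfl, Or.inr (by omega)⟩)
  omega

/-- A walk avoiding `N` cannot leave `C`, so deleting `N` separates `w` from `z`. -/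
theorem IsKConnected.le_ncard (hk : G.IsKConnected k) {N : Set V} {w z : V} (hw : w ∈ C)
    (hwN : w ∉ N) (hC : ∀ a ∈ C, ∀ b, G.Adj a b → b ∉ C → b ∈ N) (hz : z ∉ C) (hzN : z ∉ N) :
    k ≤ N.ncard := by
  classical
  by_contra! hlt
  rw [Set.ncard_eq_toFinset_card'] at hlt
  have hconn := hk.connected_induce hlt
  have key : ∀ a b : {v : V | v ∉ N.toFinset}, (G.induce _).Walk a b → a.1 ∈ C → b.1 ∈ C := by
    intro a b p
    induction p with
    | nil => exact id
    | @cons a b c hab p ih =>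
      intro ha
      by_contra hc
      have hb : b.1 ∉ C := fun hb => hc (ih hb)
      exact b.2 (by simpa using hC a.1 ha b.1 hab hb)
  obtain ⟨p⟩ := hconn.preconnected ⟨w, by simpa using hwN⟩ ⟨z, by simpa using hzN⟩
  exact hz (key _ _ p hw)

theorem IsPathList.length_le (hl : G.IsPathList l) : l.length ≤ Fintype.card V :=
  hl.2.length_le_card

/-- The predicate is left open to cover all paths, paths with given ends, and cycles. -/
theorem exists_longest {P : List V → Prop} (hP : ∀ m, P m → G.IsPathList m) (hl : P l) :
    ∃ l, P l ∧ ∀ m, P m → m.length ≤ l.length := by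
  obtain ⟨m, hm, hmin⟩ := (measure fun m : List V => Fintype.card V - m.length).wf.has_min
    {m | P m} ⟨l, hl⟩
  refine ⟨m, hm, fun m' hm' => ?_⟩
  have h1 := hmin m' hm'
  have h2 := (hP m' hm').length_le
  by_contra! h3
  exact h1 (show Fintype.card V - m'.length < Fintype.card V - m.length by omega)

theorem ncard_insert_succNeighbors (hCl : ∀ z ∈ C, z ∉ l) {w : V} (hw : w ∈ C) :
    (insert w (G.succNeighbors l C)).ncard = (G.succNeighbors l C).ncard + 1 :=
  Set.ncard_insert_of_notMem fun h => hCl w hw (succNeighbors_subset h)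

theorem ncard_insert_head_insert_succNeighbors (hl : l.Nodup) (hCl : ∀ z ∈ C, z ∉ l) {w u : V}
    (hw : w ∈ C) (hu : l.head? = some u) :
    (insert u (insert w (G.succNeighbors l C))).ncard = (G.succNeighbors l C).ncard + 2 := by
  rw [Set.ncard_insert_of_notMem, ncard_insert_succNeighbors hCl hw]
  rintro (rfl | h)
  · exact hCl _ hw (List.mem_of_mem_head? hu)
  · exact head?_notMem_succNeighbors hl hu h

theorem IsIndepSet.ncard_le {a : ℕ} (h : ∀ I : Finset V, G.IsIndepSet (I : Set V) → I.card ≤ a)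
    {s : Set V} (hs : G.IsIndepSet s) : s.ncard ≤ a := by
  classical
  rw [Set.ncard_eq_toFinset_card']
  exact h _ (by simpa using hs)

/-- **Chvátal–Erdős**, paths: a `k`-connected graph whose independent sets have at most `k + 1`
vertices has a path through all vertices. -/
theorem IsKConnected.exists_isPathList_forall_mem [Nonempty V] (hk : G.IsKConnected k)
    (hα : ∀ I : Finset V, G.IsIndepSet (I : Set V) → I.card ≤ k + 1) :
    ∃ l, G.IsPathList l ∧ l ≠ [] ∧ ∀ v, v ∈ l := by
  obtain ⟨v₀⟩ := ‹Nonempty V›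
  obtain ⟨l, hl, hlong⟩ := exists_longest (G := G) (P := G.IsPathList) (l := [v₀])
    (fun _ => id) ⟨by simp, by simp⟩
  have hne : l ≠ [] := by
    rintro rfl
    simpa using hlong [v₀] ⟨by simp, by simp⟩
  refine ⟨l, hl, hne, ?_⟩
  by_contra! hw
  obtain ⟨w, hw⟩ := hw
  obtain ⟨C, hwC, hCl, hC, hN⟩ := exists_linkedSet_of_notMem (G := G) hw
  have hmax : G.IsLongestWithEnds l := fun m hm _ _ => hlong m hm
  obtain ⟨u, hu⟩ := exists_mem_head? hne
  obtain ⟨v, hv⟩ := exists_mem_getLast? hne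
  have hsingle (h : V) : G.IsPathList [h] := ⟨by simp, by simp⟩
  have huC : ∀ h ∈ C, ¬ G.Adj u h := by
    intro h hh huh
    have := hlong ([h] ++ l) ((hsingle h).append hl (by simp_all [G.adj_comm])
      (by simpa using hCl h hh))
    simp at this
  have hvC : ∀ h ∈ C, ¬ G.Adj v h := by
    intro h hh huh
    have := hlong (l ++ [h]) (hl.append (hsingle h) (by simp_all [G.adj_comm])
      (by simpa using hCl h hh))
    simp at this
  -- With such an edge, `h`, then `A` reversed, then `B` is a longer path.
  have huT : ∀ y ∈ G.succNeighbors l C, ¬ G.Adj u y := by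
    rintro y ⟨A, B, x, rfl, hA, hB, h, hh, hxh⟩ huy
    rw [List.head?_append_of_ne_nil _ (ne_nil_of_getLast? hA)] at hu
    have := hlong ([h] ++ (A.reverse ++ B)) ((hsingle h).append
      (hl.left.reverse.append hl.right (by simp_all)
        (fun z hz => hl.disjoint (List.mem_reverse.mp hz))) ?_ ?_)
    · simp at this
    · intro a ha b hb
      rw [List.head?_append, List.head?_reverse, hA] at hb
      simp_all [G.adj_comm]
    · have := hCl h hh
      simp_all
  have hvl : v ∈ l := List.mem_of_mem_getLast? hv
  have hcard : k ≤ (G.listBoundary l C).ncard :=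
    hk.le_ncard hwC (fun h => hw h.1)
      (fun a ha b hab hb => ⟨hN a ha b hab hb, a, ha, hab.symm⟩)
      (fun h => hCl v h hvl) (fun ⟨_, h, hh, hvh⟩ => hvC h hh hvh)
  have hdiff : G.listBoundary l C \ {x | l.getLast? = some x} = G.listBoundary l C := by
    refine sdiff_eq_left.mpr (Set.disjoint_left.mpr ?_)
    rintro x ⟨-, h, hh, hxh⟩ hx
    obtain rfl : x = v := by simpa [hv] using hx
    exact hvC h hh hxh
  have h1 := ncard_listBoundary_diff_le (G := G) (C := C) hl.2
  have h2 := IsIndepSet.ncard_le hα (hmax.isIndepSet_insert_head hl hC hCl hwC huC huT)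
  rw [ncard_insert_head_insert_succNeighbors hl.2 hCl hwC hu] at h2
  rw [hdiff] at h1
  -- At least `k` successors, with `u` and `w`, make `k + 2` independent vertices.
  omega

/-- Here the ends may be adjacent to `C`; the vertex to be separated from `w` comes from
`exists_mem_forall_not_adj`. -/
theorem IsKConnected.le_ncard_listBoundary (hk : G.IsKConnected k) (hl : G.IsPathList l)
    (hmax : G.IsLongestWithEnds l) (h2 : 2 ≤ l.length)
    (hC : G.LinkedSet C) (hCl : ∀ z ∈ C, z ∉ l) {w : V} (hwC : w ∈ C)
    (hN : ∀ z ∈ C, ∀ y, G.Adj z y → y ∉ C → y ∈ l) :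
    k ≤ (G.listBoundary l C).ncard := by
  obtain ⟨z, hz, hzC⟩ := hmax.exists_mem_forall_not_adj hl h2 hC hCl
  exact hk.le_ncard hwC (fun h => hCl w hwC h.1)
    (fun a ha b hab hb => ⟨hN a ha b hab hb, a, ha, hab.symm⟩)
    (fun h => hCl z h hz) (fun ⟨_, h, hh, hvh⟩ => hzC h hh hvh)

theorem ncard_listBoundary_le_add_one (hl : l.Nodup) :
    (G.listBoundary l C).ncard ≤ (G.succNeighbors l C).ncard + 1 := by
  have h1 := ncard_listBoundary_diff_le (G := G) (C := C) hl
  have h2 : ({x | l.getLast? = some x} : Set V).ncard ≤ 1 :=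
    (Set.ncard_le_one (Set.toFinite _)).mpr fun a ha b hb => Option.some.inj (ha.symm.trans hb)
  have h3 := Set.ncard_le_ncard_sdiff_add_ncard (G.listBoundary l C) {x | l.getLast? = some x}
  omega

/-- **Chvátal–Erdős**, paths with given ends: in a `k`-connected graph whose independent sets have
fewer than `k` vertices, any two vertices are the ends of a path through all vertices. -/
theorem IsKConnected.exists_isPathList_ends (hk : G.IsKConnected k)
    (hα : ∀ I : Finset V, G.IsIndepSet (I : Set V) → I.card + 1 ≤ k) {u v : V} (huv : u ≠ v) :
    ∃ l, G.IsPathList l ∧ l.head? = some u ∧ l.getLast? = some v ∧ ∀ x, x ∈ l := by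
  have hk0 : 0 < k := by have := hα ∅ (by simp); omega
  obtain ⟨q, hq, -, hqu, hqv⟩ :=
    (hk.connected_induce (S := ∅) (by simpa using hk0)).linkedSet u (by simp) v (by simp)
  obtain ⟨l, ⟨hl, hlu, hlv⟩, hlong⟩ := exists_longest (G := G) (l := q)
    (P := fun m => G.IsPathList m ∧ m.head? = some u ∧ m.getLast? = some v)
    (fun _ h => h.1) ⟨hq, hqu, hqv⟩
  refine ⟨l, hl, hlu, hlv, ?_⟩
  by_contra! hw
  obtain ⟨w, hw⟩ := hw
  obtain ⟨C, hwC, hCl, hC, hN⟩ := exists_linkedSet_of_notMem (G := G) hw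
  have hmax : G.IsLongestWithEnds l := fun m hm h1 h2 =>
    hlong m ⟨hm, h1.trans hlu, h2.trans hlv⟩
  have h2 : 2 ≤ l.length := by
    match l, hlu, hlv with
    | [a], h1, h2 => simp_all
    | a :: b :: m, _, _ => simp
  have h3 := hk.le_ncard_listBoundary hl hmax h2 hC hCl hwC hN
  have h4 := ncard_listBoundary_le_add_one (G := G) (C := C) hl.2
  have h5 := IsIndepSet.ncard_le (a := k - 1) (fun I hI => by have := hα I hI; omega)
    (hmax.isIndepSet hl hC hCl hwC)
  rw [ncard_insert_succNeighbors hCl hwC] at h5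
  -- The last vertex may cost one successor: `k - 1` of them and `w` still exceed the bound `k - 1`.
  omega

/-- `l` lists the vertices of a cycle, or is a single edge. -/
def IsCycleList (G : SimpleGraph V) (l : List V) : Prop :=
  G.IsPathList l ∧ ∃ u v, l.head? = some u ∧ l.getLast? = some v ∧ G.Adj u v

/-- A vertex `a` has two neighbours, and these are joined by a path avoiding `a`. -/
theorem IsKConnected.exists_three_le_length_isCycleList [Nonempty V] (hk : G.IsKConnected k)
    (h2 : 2 ≤ k) : ∃ l, G.IsCycleList l ∧ 3 ≤ l.length := by
  obtain ⟨a⟩ := ‹Nonempty V›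
  have hdeg : k ≤ {x | G.Adj a x}.ncard := by
    by_cases hall : ∀ z, z ≠ a → G.Adj a z
    · have h : {x | G.Adj a x} = {a}ᶜ := by
        ext x
        exact ⟨fun h => h.ne', fun h => hall x h⟩
      rw [h, Set.ncard_compl, Set.ncard_singleton, Nat.card_eq_fintype_card]
      have := hk.lt_card
      omega
    · push Not at hall
      obtain ⟨z, hz, haz⟩ := hall
      exact hk.le_ncard (C := {a}) (w := a) (z := z) rfl (by simp)
        (by rintro _ rfl b hb _; exact hb) hz haz
  obtain ⟨b, hb, c, hc, hbc⟩ := (Set.one_lt_ncard (Set.toFinite _)).mp (h2.trans hdeg)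
  obtain ⟨q, hq, hqa, hqb, hqc⟩ := (hk.connected_induce (S := {a}) (by simpa using Nat.lt_of_succ_le h2)).linkedSet
    b (by simpa using hb.ne') c (by simpa using hc.ne')
  refine ⟨a :: q, ⟨?_, a, c, rfl, ?_, hc⟩, ?_⟩
  · have := IsPathList.append (G := G) (l := [a]) (m := q) ⟨by simp, by simp⟩ hq
      (by simpa [hqb] using hb) (by simpa using fun h => hqa a h)
    simpa using this
  · rw [List.getLast?_cons, hqc]; rfl
  · match q, hqb, hqc with
    | [x], h1, h2 => simp_all
    | x :: y :: m, _, _ => simp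

/-- **Chvátal–Erdős**, cycles: a `k`-connected graph on at least three vertices whose independent
sets have at most `k` vertices has a cycle through all vertices. -/
theorem IsKConnected.exists_isCycleList_forall_mem (hcard : 3 ≤ Fintype.card V)
    (hk : G.IsKConnected k)
    (hα : ∀ I : Finset V, G.IsIndepSet (I : Set V) → I.card ≤ k) :
    ∃ l, G.IsCycleList l ∧ ∀ v, v ∈ l := by
  classical
  have hnonempty : Nonempty V := Fintype.card_pos_iff.mp (by omega)
  rcases le_or_gt k 1 with hk1 | hk2
  · have hadj (a b : V) (hab : a ≠ b) : G.Adj a b := by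
      by_contra hn
      have := hα {a, b} (by
        simp only [Finset.coe_insert, Finset.coe_singleton]
        exact Set.pairwise_pair.mpr fun _ => ⟨hn, fun h => hn h.symm⟩)
      rw [Finset.card_pair hab] at this
      omega
    have hnodup := (Finset.univ : Finset V).nodup_toList
    have hlen : 3 ≤ (Finset.univ : Finset V).toList.length := by
      rwa [Finset.length_toList, Finset.card_univ]
    refine ⟨Finset.univ.toList, ⟨⟨?_, hnodup⟩, ?_⟩, by simp⟩
    · exact (List.Pairwise.imp (fun h => hadj _ _ h) hnodup).isChain
    · generalize (Finset.univ : Finset V).toList = l at hnodup hlen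
      match l, hlen with
      | a :: b :: m, _ =>
        obtain ⟨v, hv⟩ := exists_mem_getLast? (l := b :: m) (by simp)
        refine ⟨a, v, rfl, by rw [List.getLast?_cons, hv]; rfl, hadj _ _ ?_⟩
        rintro rfl
        exact (List.nodup_cons.mp hnodup).1 (List.mem_of_mem_getLast? hv)
  obtain ⟨q, hq, hq3⟩ := hk.exists_three_le_length_isCycleList hk2
  obtain ⟨l, ⟨hl, u, v, hlu, hlv, huv⟩, hlong⟩ := exists_longest (G := G) (l := q)
    (P := G.IsCycleList) (fun _ h => h.1) hq
  refine ⟨l, ⟨hl, u, v, hlu, hlv, huv⟩, ?_⟩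
  by_contra! hw
  obtain ⟨w, hw⟩ := hw
  obtain ⟨C, hwC, hCl, hC, hN⟩ := exists_linkedSet_of_notMem (G := G) hw
  have hmax : G.IsLongestWithEnds l := fun m hm h1 h2 =>
    hlong m ⟨hm, u, v, h1.trans hlu, h2.trans hlv, huv⟩
  have h3 := hk.le_ncard_listBoundary hl hmax (by have := hlong q hq; omega) hC hCl hwC hN
  have h4 := ncard_listBoundary_diff_le (G := G) (C := C) hl.2
  have hne : l ≠ [] := ne_nil_of_head? hlu
  -- If `v` is adjacent to `C`, its missing successor is replaced by its cyclic successor `u`.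
  by_cases hvN : ∃ h ∈ C, G.Adj v h
  · obtain ⟨h', hh', hvh'⟩ := hvN
    have huC : ∀ h ∈ C, ¬ G.Adj u h := by
      intro h hh huh
      obtain ⟨r, hr, hrC, hr1, hr2⟩ := hC h' hh' h hh
      have hrne := ne_nil_of_head? hr1
      have := hlong (l ++ r) ⟨hl.append hr (by simp_all)
        (fun z hz hz' => hCl z (hrC z hz') hz), u, h,
        by rw [List.head?_append_of_ne_nil _ hne, hlu],
        by rw [List.getLast?_append_of_ne_nil _ hrne, hr2], huh⟩
      rw [List.length_append] at this
      have := List.length_pos_iff.mpr hrne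
      omega
    have huT : ∀ y ∈ G.succNeighbors l C, ¬ G.Adj u y := by
      rintro y ⟨A, B, x, rfl, hA, hB, h, hh, hxh⟩ huy
      have hA0 := ne_nil_of_getLast? hA
      have hB0 := ne_nil_of_head? hB
      have hB1 : B.reverse ≠ [] := by simpa using hB0
      rw [List.head?_append_of_ne_nil _ hA0] at hlu
      rw [List.getLast?_append_of_ne_nil _ hB0] at hlv
      obtain ⟨r, hr, hrC, hr1, hr2⟩ := hC h hh h' hh'
      have hrne := ne_nil_of_head? hr1
      -- The longer cycle runs from `u` to `x`, through `C` to `v`, back to `y`, and closes by the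
      -- edge `u y`.
      have := hlong (A ++ (r ++ B.reverse)) ⟨hl.left.append (hr.append hl.right.reverse ?_ ?_) ?_ ?_,
        u, y, by rw [List.head?_append_of_ne_nil _ hA0, hlu], ?_, huy⟩
      · simp only [List.length_append, List.length_reverse] at this
        have := List.length_pos_iff.mpr hrne
        omega
      · intro a ha b hb
        simp_all [G.adj_comm]
      · intro z hz hz'
        apply hCl z (hrC z hz)
        simp_all
      · intro a ha b hb
        rw [List.head?_append_of_ne_nil _ hrne] at hb
        simp_all
      · intro z hz hz'
        rcases List.mem_append.mp hz' with hz' | hz'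
        · exact hCl z (hrC z hz') (List.mem_append_left _ hz)
        · exact hl.disjoint hz (by simpa using hz')
      · rw [← List.append_assoc, List.getLast?_append_of_ne_nil _ hB1, List.getLast?_reverse, hB]
    have h5 := IsIndepSet.ncard_le hα (hmax.isIndepSet_insert_head hl hC hCl hwC huC huT)
    rw [ncard_insert_head_insert_succNeighbors hl.2 hCl hwC hlu] at h5
    have h6 := ncard_listBoundary_le_add_one (G := G) (C := C) hl.2
    omega
  · have hdiff : G.listBoundary l C \ {x | l.getLast? = some x} = G.listBoundary l C := by
      refine sdiff_eq_left.mpr (Set.disjoint_left.mpr ?_)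
      rintro x ⟨-, h, hh, hxh⟩ hx
      obtain rfl : x = v := by simpa [hlv] using hx
      exact hvN ⟨h, hh, hxh⟩
    have h5 := IsIndepSet.ncard_le hα (hmax.isIndepSet hl hC hCl hwC)
    rw [ncard_insert_succNeighbors hCl hwC] at h5
    rw [hdiff] at h4
    omega

end ChvatalErdos

end SimpleGraph

namespace SimpleGraph

/-! ### From vertex lists to Hamiltonian walks -/

section Walks

variable {V : Type*} {G : SimpleGraph V} {l : List V}

theorem IsPathList.exists_walk (hl : G.IsPathList l) {u v : V} (hu : l.head? = some u)
    (hv : l.getLast? = some v) : ∃ p : G.Walk u v, p.support = l := by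
  have hne := ne_nil_of_head? hu
  obtain rfl : l.head hne = u := by
    rw [List.head?_eq_some_head hne] at hu; exact Option.some.inj hu
  obtain rfl : l.getLast hne = v := by
    rw [List.getLast?_eq_some_getLast hne] at hv; exact Option.some.inj hv
  exact ⟨Walk.ofSupport l hne hl.1, Walk.support_ofSupport hne hl.1⟩

variable [DecidableEq V]

theorem IsPathList.exists_isHamiltonian (hl : G.IsPathList l) (hmem : ∀ x, x ∈ l) {u v : V}
    (hu : l.head? = some u) (hv : l.getLast? = some v) : ∃ p : G.Walk u v, p.IsHamiltonian := by
  obtain ⟨p, rfl⟩ := hl.exists_walk hu hv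
  exact ⟨p, (Walk.IsPath.mk' hl.2).isHamiltonian_of_mem hmem⟩

theorem Walk.IsHamiltonian.isHamiltonianCycle_cons [Fintype V] (hcard : 3 ≤ Fintype.card V)
    {u v : V} {p : G.Walk u v} (hp : p.IsHamiltonian) (h : G.Adj v u) :
    (Walk.cons h p).IsHamiltonianCycle := by
  refine ⟨(Walk.cons_isCycle_iff p h).mpr ⟨hp.isPath, fun he => ?_⟩, ?_⟩
  · have hlen := hp.length_eq
    have h1 : p.length = 1 := hp.isPath.length_eq_one_of_mem_edges (Sym2.eq_swap ▸ he)
    omega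
  · intro x
    simpa using hp x

theorem IsCycleList.isHamiltonian [Fintype V] (hcard : 3 ≤ Fintype.card V) (hl : G.IsCycleList l)
    (hmem : ∀ x, x ∈ l) : G.IsHamiltonian := by
  obtain ⟨hl, u, v, hu, hv, huv⟩ := hl
  obtain ⟨p, hp⟩ := hl.exists_isHamiltonian hmem hu hv
  exact fun _ => ⟨v, _, hp.isHamiltonianCycle_cons hcard huv.symm⟩

end Walks

/-! ### Extremal complete bipartite graphs -/

section Bipartite

variable {V : Type*} {G : SimpleGraph V}

/-- Along a walk whose consecutive vertices have opposite signs, the signs add up to the mean of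
the signs of the ends. -/
theorem Walk.two_mul_sum_map_support {σ : V → ℤ} (hσ : ∀ a b, G.Adj a b → σ b = -σ a) {u v : V}
    (p : G.Walk u v) : 2 * (p.support.map σ).sum = σ u + σ v := by
  induction p with
  | nil => simp; ring
  | cons h p ih =>
    rw [Walk.support_cons, List.map_cons, List.sum_cons, mul_add, ih, hσ _ _ h]
    ring

theorem Walk.IsHamiltonian.two_mul_sum [Fintype V] [DecidableEq V] {σ : V → ℤ}
    (hσ : ∀ a b, G.Adj a b → σ b = -σ a) {u v : V} {p : G.Walk u v} (hp : p.IsHamiltonian) :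
    2 * ∑ x, σ x = σ u + σ v := by
  rw [← p.two_mul_sum_map_support hσ, ← hp.toFinset_support,
    List.sum_toFinset _ hp.isPath.support_nodup]

variable {k l : ℕ}

/-- The sign of a vertex of `K_{k,l}`: `1` on the first side and `-1` on the second. -/
def bipartiteSign : Fin k ⊕ Fin l → ℤ := Sum.elim 1 (-1)

theorem sum_bipartiteSign : ∑ x : Fin k ⊕ Fin l, bipartiteSign x = (k : ℤ) - l := by
  simp [bipartiteSign, Fintype.sum_sum_type, sub_eq_add_neg]

theorem bipartiteSign_adj (a b : Fin k ⊕ Fin l)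
    (h : (completeBipartiteGraph (Fin k) (Fin l)).Adj a b) :
    bipartiteSign b = -bipartiteSign a := by
  rcases a with a | a <;> rcases b with b | b <;> simp_all [bipartiteSign]

theorem bipartiteSign_eq_or (a : Fin k ⊕ Fin l) : bipartiteSign a = 1 ∨ bipartiteSign a = -1 := by
  rcases a with a | a <;> simp [bipartiteSign]

theorem not_isHamiltonianConnected_completeBipartiteGraph (hk : 2 ≤ k) :
    ¬ (completeBipartiteGraph (Fin k) (Fin k)).IsHamiltonianConnected := by
  intro h
  obtain ⟨p, hp⟩ := h (Sum.inl ⟨0, by omega⟩) (Sum.inl ⟨1, by omega⟩) (by simp)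
  have := hp.two_mul_sum bipartiteSign_adj
  rw [sum_bipartiteSign] at this
  simp [bipartiteSign] at this

theorem not_isTraceable_completeBipartiteGraph (h : k + 2 ≤ l) :
    ¬ (completeBipartiteGraph (Fin k) (Fin l)).IsTraceable := by
  rintro ⟨u, v, p, hp⟩
  have h1 := hp.two_mul_sum bipartiteSign_adj
  rw [sum_bipartiteSign] at h1
  have hu := bipartiteSign_eq_or u
  have hv := bipartiteSign_eq_or v
  omega

/-- Removing an edge from the cycle leaves a Hamiltonian path with ends of opposite sign, forcing `k
= l`. By convention a one-vertex graph is Hamiltonian, hence `hcard`. -/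
theorem not_isHamiltonian_completeBipartiteGraph (hkl : k ≠ l) (hcard : k + l ≠ 1) :
    ¬ (completeBipartiteGraph (Fin k) (Fin l)).IsHamiltonian := by
  intro h
  obtain ⟨a, p, hp⟩ := h (by simpa using hcard)
  have h1 := hp.isHamiltonian_tail.two_mul_sum bipartiteSign_adj
  have h2 := bipartiteSign_adj _ _ (p.adj_snd hp.isCycle.not_nil)
  rw [sum_bipartiteSign] at h1
  omega

theorem isKConnected_completeBipartiteGraph (hkl : k ≤ l) (hl : 2 ≤ l) :
    (completeBipartiteGraph (Fin k) (Fin l)).IsKConnected k := by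
  refine le_csInf ⟨_, Finset.univ, rfl, Or.inr (Nat.le_succ _)⟩ ?_
  rintro m ⟨S, rfl, hS | hS⟩
  · by_contra! hlt
    apply hS
    obtain ⟨a, ha⟩ : ∃ a : Fin k, (Sum.inl a : Fin k ⊕ Fin l) ∉ S := by
      by_contra! h
      have := Finset.card_le_card (show Finset.univ.map Function.Embedding.inl ⊆ S from
        fun x hx => by obtain ⟨a, -, rfl⟩ := Finset.mem_map.mp hx; exact h a)
      simp at this
      omega
    obtain ⟨b, hb⟩ : ∃ b : Fin l, (Sum.inr b : Fin k ⊕ Fin l) ∉ S := by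
      by_contra! h
      have := Finset.card_le_card (show Finset.univ.map Function.Embedding.inr ⊆ S from
        fun x hx => by obtain ⟨a, -, rfl⟩ := Finset.mem_map.mp hx; exact h a)
      simp at this
      omega
    set K := (completeBipartiteGraph (Fin k) (Fin l)).induce {v | v ∉ S}
    have hab : K.Adj ⟨Sum.inl a, ha⟩ ⟨Sum.inr b, hb⟩ := by simp [K]
    rw [connected_iff_exists_forall_reachable]
    refine ⟨⟨Sum.inl a, ha⟩, ?_⟩
    rintro ⟨c | c, hc⟩
    · exact hab.reachable.trans (Adj.reachable (by simp [K]))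
    · exact Adj.reachable (by simp [K])
  · rw [Fintype.card_sum, Fintype.card_fin, Fintype.card_fin] at hS
    omega

variable [DecidableRel (completeBipartiteGraph (Fin k) (Fin l)).Adj]

theorem degree_completeBipartiteGraph_inl (a : Fin k) :
    (completeBipartiteGraph (Fin k) (Fin l)).degree (Sum.inl a) = l := by
  have h : (completeBipartiteGraph (Fin k) (Fin l)).neighborFinset (Sum.inl a) =
      Finset.univ.map Function.Embedding.inr := by
    ext x; rcases x with x | x <;> simp
  rw [← card_neighborFinset_eq_degree, h]
  simp

theorem degree_completeBipartiteGraph_inr (b : Fin l) :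
    (completeBipartiteGraph (Fin k) (Fin l)).degree (Sum.inr b) = k := by
  have h : (completeBipartiteGraph (Fin k) (Fin l)).neighborFinset (Sum.inr b) =
      Finset.univ.map Function.Embedding.inl := by
    ext x; rcases x with x | x <;> simp
  rw [← card_neighborFinset_eq_degree, h]
  simp

theorem minDegree_completeBipartiteGraph (hl : 0 < l) (hkl : k ≤ l) :
    (completeBipartiteGraph (Fin k) (Fin l)).minDegree = k := by
  have : Nonempty (Fin k ⊕ Fin l) := ⟨Sum.inr ⟨0, hl⟩⟩
  apply le_antisymm
  · exact (minDegree_le_degree _ (Sum.inr ⟨0, hl⟩)).trans_eq (degree_completeBipartiteGraph_inr _)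
  · refine le_minDegree_of_forall_le_degree _ _ ?_
    rintro (a | b)
    · rwa [degree_completeBipartiteGraph_inl]
    · rw [degree_completeBipartiteGraph_inr]

theorem laplacianSpectralRadius_completeBipartiteGraph (hk : 0 < k) (hl : 0 < l) :
    (completeBipartiteGraph (Fin k) (Fin l)).laplacianSpectralRadius = (k : ℝ) + l := by
  apply le_antisymm
  · simpa using laplacianSpectralRadius_le_card (completeBipartiteGraph (Fin k) (Fin l))
  -- Constant on each side and orthogonal to the constants: an eigenvector for `k + l`.
  · refine le_laplacianSpectralRadius _ (x := Sum.elim (fun _ => (l : ℝ)) (fun _ => -(k : ℝ))) ?_ ?_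
    · intro h
      have := congrFun h (Sum.inl ⟨0, hk⟩)
      simp at this
      omega
    · ext v
      rw [lapMatrix_mulVec_apply, neighborFinset_eq_filter, Finset.sum_filter,
        Fintype.sum_sum_type]
      rcases v with a | b
      · simp [degree_completeBipartiteGraph_inl]; ring
      · simp [degree_completeBipartiteGraph_inr]; ring

end Bipartite

/-! ### Spectral condition and conclusion -/

section Main

variable {V : Type*} [Fintype V] [DecidableEq V] (G : SimpleGraph V) [DecidableRel G.Adj]

/-- The spectral condition bounds the independence number by `k - s`. -/
theorem card_add_le_of_laplacianSpectralRadius_lt [Nonempty V] {k : ℕ} {s : ℤ}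
    (h : G.laplacianSpectralRadius <
      (Fintype.card V : ℝ) * (G.minDegree : ℝ) / ((Fintype.card V : ℝ) - k + s - 1))
    (I : Finset V) (hI : G.IsIndepSet (I : Set V)) : (I.card : ℤ) + s ≤ k := by
  have hnd : (0 : ℝ) ≤ (Fintype.card V : ℝ) * G.minDegree := by positivity
  have hμ := G.laplacianSpectralRadius_nonneg
  -- A nonpositive denominator, including zero since `x / 0 = 0`, would give `μ₁ < 0`.
  have hpos : 0 < (Fintype.card V : ℝ) - k + s - 1 := by
    by_contra! hle
    exact absurd (h.trans_le (div_nonpos_of_nonneg_of_nonpos hnd hle)) hμ.not_gt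
  rw [lt_div_iff₀ hpos] at h
  have key (J : Finset V) (hJ : G.IsIndepSet (J : Set V)) (hne : J.Nonempty) :
      (J.card : ℤ) + s ≤ k := by
    have h2 := lt_of_mul_lt_mul_left (h.trans_le (hJ.card_mul_minDegree_le G hne)) hμ
    have h3 : (J.card : ℝ) + s < k + 1 := by linarith
    exact Int.lt_add_one_iff.mp (by exact_mod_cast h3)
  rcases I.eq_empty_or_nonempty with rfl | hne
  -- The ratio bound needs a nonempty set; a singleton gives more than is needed.
  · obtain ⟨v⟩ := ‹Nonempty V›
    have := key {v} (by simp) (by simp)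
    simp at this ⊢
    omega
  · exact key I hI hne

end Main

end SimpleGraph

theorem theorem1p4 :
    (∀ {V : Type*} [Fintype V] [DecidableEq V] (G : SimpleGraph V) [DecidableRel G.Adj]
      (k : ℕ) (s : ℤ),
      3 ≤ Fintype.card V →
      G.IsKConnected k →
      G.laplacianSpectralRadius <
        (Fintype.card V : ℝ) * (G.minDegree : ℝ) / ((Fintype.card V : ℝ) - k + s - 1) →
      (s = 1 → G.IsHamiltonianConnected) ∧
      (s = 0 → G.IsHamiltonian) ∧
      (s = -1 → G.IsTraceable)) ∧
    -- sharpness: equality in the spectral condition does not suffice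
    (∀ (k l : ℕ) (s : ℤ) [DecidableRel (completeBipartiteGraph (Fin k) (Fin l)).Adj],
      (s = 1 ∨ s = 0 ∨ s = -1) →
      (l : ℤ) = k - s + 1 →
      3 ≤ Fintype.card (Fin k ⊕ Fin l) →
      (completeBipartiteGraph (Fin k) (Fin l)).IsKConnected k ∧
      (completeBipartiteGraph (Fin k) (Fin l)).laplacianSpectralRadius = 2 * (k : ℝ) - s + 1 ∧
      (completeBipartiteGraph (Fin k) (Fin l)).laplacianSpectralRadius =
        (Fintype.card (Fin k ⊕ Fin l) : ℝ) *
            ((completeBipartiteGraph (Fin k) (Fin l)).minDegree : ℝ) /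
          ((Fintype.card (Fin k ⊕ Fin l) : ℝ) - k + s - 1) ∧
      (s = 1 → ¬ (completeBipartiteGraph (Fin k) (Fin l)).IsHamiltonianConnected) ∧
      (s = 0 → ¬ (completeBipartiteGraph (Fin k) (Fin l)).IsHamiltonian) ∧
      (s = -1 → ¬ (completeBipartiteGraph (Fin k) (Fin l)).IsTraceable)) := by
  refine ⟨?_, ?_⟩
  · intro V _ _ G _ k s hcard hk h
    have hne : Nonempty V := Fintype.card_pos_iff.mp (by omega)
    have hα := G.card_add_le_of_laplacianSpectralRadius_lt h
    refine ⟨?_, ?_, ?_⟩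
    · rintro rfl u v huv
      obtain ⟨l, hl, hu, hv, hmem⟩ :=
        hk.exists_isPathList_ends (fun I hI => by have := hα I hI; omega) huv
      exact hl.exists_isHamiltonian hmem hu hv
    · rintro rfl
      obtain ⟨l, hl, hmem⟩ :=
        hk.exists_isCycleList_forall_mem hcard (fun I hI => by have := hα I hI; omega)
      exact hl.isHamiltonian hcard hmem
    · rintro rfl
      obtain ⟨l, hl, hl0, hmem⟩ :=
        hk.exists_isPathList_forall_mem (fun I hI => by have := hα I hI; omega)
      obtain ⟨u, hu⟩ := SimpleGraph.exists_mem_head? hl0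
      obtain ⟨v, hv⟩ := SimpleGraph.exists_mem_getLast? hl0
      exact ⟨u, v, hl.exists_isHamiltonian hmem hu hv⟩
  · intro k l s _ hs hl hcard
    rw [Fintype.card_sum, Fintype.card_fin, Fintype.card_fin] at hcard
    have hkl : k ≤ l := by omega
    -- For `k = 0` one would have `l = 1 - s ≤ 2`, too few vertices.
    have hk0 : 0 < k := by omega
    have hl2 : 2 ≤ l := by omega
    have hlR : (l : ℝ) = k - s + 1 := by exact_mod_cast hl
    have hkR : (k : ℝ) ≠ 0 := by positivity
    have hμ := SimpleGraph.laplacianSpectralRadius_completeBipartiteGraph hk0 (hk0.trans_le hkl)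
    refine ⟨SimpleGraph.isKConnected_completeBipartiteGraph hkl hl2, ?_, ?_, ?_, ?_, ?_⟩
    · rw [hμ, hlR]
      ring
    · rw [hμ, SimpleGraph.minDegree_completeBipartiteGraph (hk0.trans_le hkl) hkl,
        Fintype.card_sum, Fintype.card_fin, Fintype.card_fin, Nat.cast_add, hlR]
      rw [show (k : ℝ) + (k - s + 1) - k + s - 1 = k by ring, mul_div_cancel_right₀ _ hkR]
    · rintro rfl
      obtain rfl : l = k := by omega
      exact SimpleGraph.not_isHamiltonianConnected_completeBipartiteGraph hl2
    · rintro rfl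
      exact SimpleGraph.not_isHamiltonian_completeBipartiteGraph (by omega) (by omega)
    · rintro rfl
      exact SimpleGraph.not_isTraceable_completeBipartiteGraph (by omega)
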